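/- Theorem 1.5. Let $(T,\mathcal F,\mu)$ be a measure space with $0<\mu(T)<+\infty$ which is non-atomic, i.e. every $A\in\mathcal F$ with $\mu(A)>0$ contains some $B\in\mathcal F$ with $0<\mu(B)<\mu(A)$. Let $E$ be a real Banach space, let $p\in[1,+\infty)$, and let $f,g:E\to\mathbb R$ be two functions, with $f$ lower semicontinuous and $g$ continuous, such that $$\sup_E f<+\infty,\qquad \inf_E g=-\infty,\qquad \sup_E g=+\infty,$$ $$\max\left\{\sup_{x\in E}\frac{|f(x)|}{1+\|x\|^p},\ \sup_{x\in E}\frac{|g(x)|}{1+\|x\|^p}\right\}<+\infty .$$ Assume that $f$ has at most one global minimum (that is, there is at most one point $x\in E$ with $f(x)=\min_E f$), and that no zero of $g$ is a global minimum of $f$. Then for every $u\in L^p(T,E)$ the functions $f\circ u$ and $g\circ u$ are $\mu$-integrable, so that $$J(u)=\int_T f(u(t))\,d\mu+\left(\int_T g(u(t))\,d\mu\right)^2$$ is a well-defined real number. Moreover, let $X\subseteq L^p(T,E)$ contain (the classes of) all constant functions and be decomposable, i.e. for all $u,v\in X$ and $A\in\mathcal F$ the function $\chi_A u+(1-\chi_A)v$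 belongs to $X$. Then the restriction of $J$ to $X$ has no global minimum, i.e. there is no $u\in X$ with $J(u)\le J(v)$ for all $v\in X$. -/

import Mathlib

open MeasureTheory

/-- A measure is non-atomic if it has no atoms in the measure-theoretic sense: every measurable
set of positive measure has a measurable subset of strictly smaller positive measure.
This is in general stronger than all singletons being null. -/
def IsNonatomicMeasure {T : Type*} [MeasurableSpace T] (μ : Measure T) : Prop :=
  ∀ A : Set T, MeasurableSet A → 0 < μ A →
    ∃ B : Set T, MeasurableSet B ∧ B ⊆ A ∧ 0 < μ B ∧ μ B < μ A

/-- A set `D` of (classes of) `L^p` functions is decomposable if for all `u, v ∈ D` and every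
measurable set `A` the class of `χ_A u + (1 - χ_A) v` belongs to `D`. -/
def IsDecomposable {T E : Type*} [MeasurableSpace T] [NormedAddCommGroup E] [NormedSpace ℝ E]
    {p : ENNReal} {μ : Measure T} (D : Set (Lp E p μ)) : Prop :=
  ∀ u ∈ D, ∀ v ∈ D, ∀ A : Set T, MeasurableSet A →
    ∃ w ∈ D, (w : T → E) =ᵐ[μ] fun t =>
      A.indicator (fun _ => (1 : ℝ)) t • u t + (1 - A.indicator (fun _ => (1 : ℝ)) t) • v t

/-- The functional `J(u) = ∫ f(u(t)) dμ + (∫ g(u(t)) dμ)²` on `L^p(T, E)`. -/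
noncomputable def integralFunctional {T E : Type*} [MeasurableSpace T] [NormedAddCommGroup E]
    {p : ENNReal} {μ : Measure T} (f g : E → ℝ) (u : Lp E p μ) : ℝ :=
  (∫ t, f (u t) ∂μ) + (∫ t, g (u t) ∂μ) ^ 2

/-! Suppose `u` minimizes J on X and put c = ∫ g∘u. Replacing `u` by `v` on A changes J by exactly
∫_A h + (∫_A k)², with k = g∘v - g∘u and h = (f∘v - f∘u) + 2ck. Non-atomicity gives sets A so small
that the square is negligible, so minimality forces h ≥ 0 a.e. Testing with constants `v` bounds f +
2cg below; as f is bounded above and g is unbounded on both sides, c = 0. Then u(t) minimizes f for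
a.e. t, so `u` is a.e. the unique minimizer, where g must vanish because c = 0: a contradiction. -/

/-- In a non-atomic measure space every measurable set of positive finite measure has measurable
subsets of arbitrarily small positive measure. -/
theorem IsNonatomicMeasure.exists_subset_lt {T : Type*} [MeasurableSpace T] {μ : Measure T}
    [IsFiniteMeasure μ] (hμ : IsNonatomicMeasure μ) {S : Set T} (hS : MeasurableSet S)
    (hS0 : 0 < μ S) {δ : ℝ} (hδ : 0 < δ) :
    ∃ A : Set T, MeasurableSet A ∧ A ⊆ S ∧ 0 < μ.real A ∧ μ.real A < δ := by
  have half : ∀ A : Set T, MeasurableSet A → 0 < μ.real A →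
      ∃ B : Set T, MeasurableSet B ∧ B ⊆ A ∧ 0 < μ.real B ∧ μ.real B ≤ μ.real A / 2 := by
    intro A hA hA0
    obtain ⟨B, hB, hBA, hB0, hlt⟩ := hμ A hA (by
      rw [measureReal_def, ENNReal.toReal_pos_iff] at hA0; exact hA0.1)
    have hB0' : 0 < μ.real B := ENNReal.toReal_pos hB0.ne' (measure_ne_top μ B)
    have hlt' : μ.real B < μ.real A :=
      (ENNReal.toReal_lt_toReal (measure_ne_top μ B) (measure_ne_top μ A)).2 hlt
    have hdiff : μ.real (A \ B) = μ.real A - μ.real B := measureReal_sdiff hBA hB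
    -- One of B and A \ B has at most half the measure of A.
    rcases le_total (μ.real B) (μ.real A / 2) with h | h
    · exact ⟨B, hB, hBA, hB0', h⟩
    · exact ⟨A \ B, hA.diff hB, Set.sdiff_subset, by linarith, by linarith⟩
  have iter : ∀ n : ℕ, ∃ A : Set T, MeasurableSet A ∧ A ⊆ S ∧ 0 < μ.real A ∧
      μ.real A ≤ μ.real S * (1 / 2) ^ n := by
    intro n
    induction n with
    | zero =>
      exact ⟨S, hS, subset_rfl, ENNReal.toReal_pos hS0.ne' (measure_ne_top μ S), by simp⟩
    | succ n ih =>
      obtain ⟨A, hA, hAS, hA0, hle⟩ := ih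
      obtain ⟨B, hB, hBA, hB0, hBle⟩ := half A hA hA0
      exact ⟨B, hB, hBA.trans hAS, hB0, by rw [pow_succ]; linarith⟩
  have hlim : Filter.Tendsto (fun n : ℕ => μ.real S * (1 / 2 : ℝ) ^ n) Filter.atTop (nhds 0) := by
    simpa using (tendsto_pow_atTop_nhds_zero_of_lt_one (by norm_num : (0 : ℝ) ≤ 1 / 2)
      (by norm_num)).const_mul (μ.real S)
  obtain ⟨n, hn⟩ := (hlim.eventually_lt_const hδ).exists
  obtain ⟨A, hA, hAS, hA0, hle⟩ := iter n
  exact ⟨A, hA, hAS, hA0, hle.trans_lt hn⟩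

/-- The superposition of a Borel function of growth at most `1 + ‖x‖ ^ p` with an `L^p` function
is integrable. -/
theorem integrable_comp_of_growth {T E : Type*} [MeasurableSpace T] {μ : Measure T}
    [IsFiniteMeasure μ] [NormedAddCommGroup E] {p : ℝ} (hp : 0 < p) {f : E → ℝ}
    (hf : Measurable[borel E] f)
    (hf_growth : BddAbove (Set.range fun x : E => |f x| / (1 + ‖x‖ ^ p)))
    (u : Lp E (ENNReal.ofReal p) μ) : Integrable (fun t => f (u t)) μ := by
  borelize E
  obtain ⟨C, hC⟩ := hf_growth
  have hu : Integrable (fun t => ‖u t‖ ^ p) μ := by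
    have := (Lp.memLp u).integrable_norm_rpow (by simpa using hp) ENNReal.ofReal_ne_top
    rwa [ENNReal.toReal_ofReal hp.le] at this
  refine Integrable.mono' (((integrable_const (1 : ℝ)).add hu).const_mul C)
    (hf.comp (Lp.stronglyMeasurable u).measurable).aestronglyMeasurable
    (Filter.Eventually.of_forall fun t => ?_)
  have h := hC (Set.mem_range_self (u t))
  rw [div_le_iff₀ (by positivity)] at h
  exact h

/-- In a non-atomic space, if `h` is not almost everywhere nonnegative, then for every integrable
`k` some measurable set `A` satisfies `∫_A h + (∫_A k)² < 0`. -/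
theorem IsNonatomicMeasure.exists_setIntegral_add_sq_neg {T : Type*} [MeasurableSpace T]
    {μ : Measure T} [IsFiniteMeasure μ] (hμ : IsNonatomicMeasure μ) {h k : T → ℝ}
    (hh : Integrable h μ) (hk : Integrable k μ) (hneg : ¬ ∀ᵐ t ∂μ, 0 ≤ h t) :
    ∃ A : Set T, MeasurableSet A ∧ (∫ t in A, h t ∂μ) + (∫ t in A, k t ∂μ) ^ 2 < 0 := by
  obtain ⟨n, hn⟩ : ∃ n : ℕ, 0 < μ {t | h t ≤ -(1 / ((n : ℝ) + 1)) ∧ |k t| ≤ n} := by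
    by_contra! hcon
    refine hneg ?_
    have hnull : ∀ᵐ t ∂μ, ∀ n : ℕ, ¬ (h t ≤ -(1 / ((n : ℝ) + 1)) ∧ |k t| ≤ n) :=
      ae_all_iff.2 fun n => by
        rw [ae_iff]; simpa only [not_not] using nonpos_iff_eq_zero.1 (hcon n)
    filter_upwards [hnull] with t ht
    by_contra! hlt
    obtain ⟨n₁, h₁⟩ := exists_nat_one_div_lt (neg_pos.2 hlt)
    obtain ⟨n₂, h₂⟩ := exists_nat_ge |k t|
    refine ht (max n₁ n₂) ⟨?_, h₂.trans (by exact_mod_cast le_max_right _ _)⟩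
    have : 1 / (((max n₁ n₂ : ℕ) : ℝ) + 1) ≤ 1 / ((n₁ : ℝ) + 1) := by
      apply one_div_le_one_div_of_le (by positivity)
      have : (n₁ : ℝ) ≤ ((max n₁ n₂ : ℕ) : ℝ) := by exact_mod_cast le_max_left _ _
      linarith
    linarith
  have hSm : NullMeasurableSet {t | h t ≤ -(1 / ((n : ℝ) + 1)) ∧ |k t| ≤ n} μ :=
    (nullMeasurableSet_le hh.aemeasurable aemeasurable_const).inter
      (nullMeasurableSet_le hk.aemeasurable.abs aemeasurable_const)
  obtain ⟨S, hSsub, hS, hSae⟩ := hSm.exists_measurable_subset_ae_eq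
  -- With m = μ(A), the sum is at most -m/(n+1) + n²m², negative once m(n²+1) < 1/(n+1).
  obtain ⟨A, hA, hAS, hA0, hAδ⟩ := hμ.exists_subset_lt hS (by rwa [measure_congr hSae])
    (δ := 1 / ((n : ℝ) + 1) / ((n : ℝ) ^ 2 + 1)) (by positivity)
  refine ⟨A, hA, ?_⟩
  have h₁ : ∫ t in A, h t ∂μ ≤ -(1 / ((n : ℝ) + 1)) * μ.real A := by
    have := setIntegral_mono_on hh.integrableOn
      (integrableOn_const (C := -(1 / ((n : ℝ) + 1))) (measure_ne_top μ A)) hA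
      fun t ht => (hSsub (hAS ht)).1
    simpa [mul_comm] using this
  have h₂ : |∫ t in A, k t ∂μ| ≤ n * μ.real A :=
    norm_setIntegral_le_of_norm_le_const (f := k) (measure_lt_top μ A)
      fun t ht => (hSsub (hAS ht)).2
  have h₃ : (∫ t in A, k t ∂μ) ^ 2 ≤ (n * μ.real A) ^ 2 := by
    rw [← sq_abs]; gcongr
  rw [lt_div_iff₀ (by positivity)] at hAδ
  nlinarith [mul_lt_mul_of_pos_left hAδ hA0, mul_pos hA0 hA0]

/-- Replacing `u` by `v` on `A` changes the integral of `f ∘ u` by the integral over `A` of the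
difference. -/
theorem integral_comp_of_ae_eq_indicator {T E : Type*} [MeasurableSpace T] {μ : Measure T}
    [NormedAddCommGroup E] [NormedSpace ℝ E] {f : E → ℝ} {u v w : T → E} {A : Set T}
    (hA : MeasurableSet A)
    (hw : w =ᵐ[μ] fun t =>
      A.indicator (fun _ => (1 : ℝ)) t • v t + (1 - A.indicator (fun _ => (1 : ℝ)) t) • u t)
    (hu : Integrable (fun t => f (u t)) μ) (hv : Integrable (fun t => f (v t)) μ) :
    ∫ t, f (w t) ∂μ = (∫ t, f (u t) ∂μ) + ∫ t in A, (f (v t) - f (u t)) ∂μ := by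
  have hd : Integrable (fun t => f (v t) - f (u t)) μ := hv.sub hu
  rw [← integral_indicator hA, ← integral_add hu (hd.indicator hA)]
  refine integral_congr_ae ?_
  filter_upwards [hw] with t ht
  by_cases htA : t ∈ A <;> simp [ht, htA]

/-- First-order condition: at a minimizer `u` of the integral functional on a decomposable set,
with `c = ∫ g ∘ u`, the function `f + 2 c g` is pointwise no larger along `u` than along any other
member of the set. -/
theorem ae_le_of_isMinOn_integralFunctional {T E : Type*} [MeasurableSpace T] {μ : Measure T}
    [IsFiniteMeasure μ] (hμ : IsNonatomicMeasure μ) [NormedAddCommGroup E] [NormedSpace ℝ E]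
    {p : ENNReal} {f g : E → ℝ}
    (hf : ∀ u : Lp E p μ, Integrable (fun t => f (u t)) μ)
    (hg : ∀ u : Lp E p μ, Integrable (fun t => g (u t)) μ)
    {X : Set (Lp E p μ)} (hX : IsDecomposable X) {u v : Lp E p μ} (hu : u ∈ X) (hv : v ∈ X)
    (hmin : IsMinOn (integralFunctional f g) X u) :
    ∀ᵐ t ∂μ, f (u t) + 2 * (∫ s, g (u s) ∂μ) * g (u t) ≤
      f (v t) + 2 * (∫ s, g (u s) ∂μ) * g (v t) := by
  set c := ∫ s, g (u s) ∂μ with hc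
  by_contra hcon
  have hfi := (hf v).sub (hf u)
  have hgi := (hg v).sub (hg u)
  obtain ⟨A, hA, hneg⟩ := hμ.exists_setIntegral_add_sq_neg
    (h := fun t => (f (v t) - f (u t)) + 2 * c * (g (v t) - g (u t)))
    (k := fun t => g (v t) - g (u t)) (hfi.add (hgi.const_mul _)) hgi (by
      refine fun h => hcon (h.mono fun t ht => ?_)
      linarith)
  obtain ⟨w, hwX, hw⟩ := hX v hv u hu A hA
  have hle := isMinOn_iff.1 hmin w hwX
  have hsplit := integral_add (μ := μ.restrict A) hfi.integrableOn
    (hgi.const_mul (2 * c)).integrableOn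
  simp only [Pi.sub_apply] at hsplit
  rw [hsplit, integral_const_mul] at hneg
  simp only [integralFunctional] at hle
  rw [integral_comp_of_ae_eq_indicator hA hw (hf u) (hf v),
    integral_comp_of_ae_eq_indicator hA hw (hg u) (hg v), ← hc] at hle
  linarith

theorem theorem1p5 {T E : Type*} [MeasurableSpace T] (μ : Measure T) [IsFiniteMeasure μ]
    (hμ_pos : 0 < μ Set.univ) (hμ : IsNonatomicMeasure μ)
    [NormedAddCommGroup E] [NormedSpace ℝ E] [CompleteSpace E]
    (p : ℝ) (hp : 1 ≤ p) (f g : E → ℝ)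
    (hf : LowerSemicontinuous f) (hg : Continuous g)
    (hf_above : BddAbove (Set.range f))
    (hg_below : ¬ BddBelow (Set.range g)) (hg_above : ¬ BddAbove (Set.range g))
    (hf_growth : BddAbove (Set.range fun x : E => |f x| / (1 + ‖x‖ ^ p)))
    (hg_growth : BddAbove (Set.range fun x : E => |g x| / (1 + ‖x‖ ^ p)))
    (hf_min : {x : E | IsMinOn f Set.univ x}.Subsingleton)
    (hfg : ∀ x : E, g x = 0 → ¬ IsMinOn f Set.univ x) :
    -- the functional is well defined: both integrands are integrable
    (∀ u : Lp E (ENNReal.ofReal p) μ,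
      Integrable (fun t => f (u t)) μ ∧ Integrable (fun t => g (u t)) μ) ∧
    ∀ X : Set (Lp E (ENNReal.ofReal p) μ), IsDecomposable X →
      (∀ c : E, Lp.const (ENNReal.ofReal p) μ c ∈ X) →
      ¬ ∃ u ∈ X, IsMinOn (integralFunctional f g) X u := by
  have hp0 : 0 < p := by linarith
  have hfI : ∀ u : Lp E (ENNReal.ofReal p) μ, Integrable (fun t => f (u t)) μ :=
    integrable_comp_of_growth hp0 (by borelize E; exact hf.measurable) hf_growth
  have hgI : ∀ u : Lp E (ENNReal.ofReal p) μ, Integrable (fun t => g (u t)) μ :=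
    integrable_comp_of_growth hp0 (by borelize E; exact hg.measurable) hg_growth
  refine ⟨fun u => ⟨hfI u, hgI u⟩, ?_⟩
  rintro X hX hconst ⟨u, huX, hmin⟩
  have hm : 0 < μ.real Set.univ := ENNReal.toReal_pos hμ_pos.ne' (measure_ne_top μ _)
  have : NeZero μ := ⟨fun h => by simp [h] at hμ_pos⟩
  set c := ∫ t, g (u t) ∂μ with hc
  have hae : ∀ x : E, ∀ᵐ t ∂μ, f (u t) + 2 * c * g (u t) ≤ f x + 2 * c * g x := by
    intro x
    filter_upwards [ae_le_of_isMinOn_integralFunctional hμ hfI hgI hX huX (hconst x) hmin,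
      Lp.coeFn_const (p := ENNReal.ofReal p) (μ := μ) x] with t h₁ h₂
    rwa [h₂] at h₁
  -- The null set in `hae` depends on x, and E may be non-separable; integrating in t gives a bound
  -- valid for every x.
  have hint : ∀ x : E, (∫ t, f (u t) ∂μ) + 2 * c * c ≤ (f x + 2 * c * g x) * μ.real Set.univ := by
    intro x
    have := integral_mono_ae ((hfI u).add ((hgI u).const_mul (2 * c)))
      (integrable_const (f x + 2 * c * g x)) (hae x)
    simp only [Pi.add_apply] at this
    rw [integral_add (hfI u) ((hgI u).const_mul _), integral_const_mul, ← hc, integral_const,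
      smul_eq_mul] at this
    linarith
  obtain ⟨M, hM⟩ := hf_above
  have hbdd : ∀ x : E, ((∫ t, f (u t) ∂μ) + 2 * c * c) / μ.real Set.univ - M ≤ 2 * c * g x := by
    intro x
    have h₁ := (div_le_iff₀ hm).2 (hint x)
    have h₂ := hM (Set.mem_range_self x)
    linarith
  have hc0 : c = 0 := by
    rcases lt_trichotomy c 0 with h | h | h
    · refine absurd
        ⟨(((∫ t, f (u t) ∂μ) + 2 * c * c) / μ.real Set.univ - M) / (2 * c), ?_⟩ hg_above
      rintro _ ⟨x, rfl⟩
      rw [le_div_iff_of_neg (by linarith)]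
      linarith [hbdd x]
    · exact h
    · refine absurd
        ⟨(((∫ t, f (u t) ∂μ) + 2 * c * c) / μ.real Set.univ - M) / (2 * c), ?_⟩ hg_below
      rintro _ ⟨x, rfl⟩
      rw [div_le_iff₀ (by linarith)]
      linarith [hbdd x]
  simp only [hc0, mul_zero, zero_mul, add_zero] at hae hint
  have hnonneg : ∀ x, 0 ≤ f x - (∫ t, f (u t) ∂μ) / μ.real Set.univ := fun x =>
    sub_nonneg.2 ((div_le_iff₀ hm).2 (hint x))
  -- The mean of f∘u is a lower bound of f, so f∘u equals it a.e.
  have hzero : ∫ t, (f (u t) - (∫ s, f (u s) ∂μ) / μ.real Set.univ) ∂μ = 0 := by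
    rw [integral_sub (hfI u) (integrable_const _), integral_const, smul_eq_mul]
    field_simp
    ring
  have hminae : ∀ᵐ t ∂μ, IsMinOn f Set.univ (u t) := by
    filter_upwards [(integral_eq_zero_iff_of_nonneg (fun t => hnonneg (u t))
      ((hfI u).sub (integrable_const _))).1 hzero] with t ht
    refine isMinOn_iff.2 fun x _ => ?_
    have := hnonneg x
    simp only [Pi.zero_apply] at ht
    linarith
  obtain ⟨t₀, ht₀⟩ := hminae.exists
  have hgu : ∫ t, g (u t) ∂μ = g (u t₀) * μ.real Set.univ := by
    rw [integral_congr_ae (g := fun _ => g (u t₀))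
      (hminae.mono fun t ht => by simp only [hf_min ht ht₀]), integral_const, smul_eq_mul, mul_comm]
  refine hfg (u t₀) ?_ ht₀
  rw [← hc, hc0] at hgu
  exact (mul_eq_zero.1 hgu.symm).resolve_right hm.ne'
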